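/- Let $M$ be a smooth $n$-dimensional manifold with a smooth Lorentzian metric $g$ of signature $(-,+,\dots,+)$ and Levi-Civita connection $\nabla$. Let $Z$ be a smooth vector field on $M$ that is covariantly constant, $\nabla Z=0$, and null, i.e. $Z_x\neq 0$ and $g_x(Z_x,Z_x)=0$ for every $x\in M$. Then every point $p\in M$ has an open neighbourhood $U$ which is the domain of a smooth coordinate chart $\varphi=(u,v,x^1,\dots,x^{n-2})$ of $M$ (in particular $n\ge 2$) such that $$Z|_U=\partial_v=\operatorname{grad}u ,$$ where $\partial_v$ is the coordinate vector field of $v$ in the chart $\varphi$, and $\operatorname{grad}u$ is the gradient of $u$ with respect to $g$, defined by $g(\operatorname{grad}u,X)=du(X)$ for all tangent vectors $X$. -/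

import Mathlib

open Bundle Manifold ContDiff VectorField

noncomputable section

/-- A smooth Lorentzian metric, of signature `(-, +, …, +)`, on a smooth `n`-manifold without
boundary. -/
structure LorentzMetric (n : ℕ) (M : Type*) [TopologicalSpace M]
    [ChartedSpace (EuclideanSpace ℝ (Fin n)) M] [IsManifold (𝓡 n) ∞ M] where
  /-- The bilinear form on each tangent space. -/
  val (x : M) : TangentSpace (𝓡 n) x →L[ℝ] TangentSpace (𝓡 n) x →L[ℝ] ℝ
  symm (x : M) (v w : TangentSpace (𝓡 n) x) : val x v w = val x w v
  signature (x : M) : ∃ (e : Module.Basis (Fin n) ℝ (TangentSpace (𝓡 n) x)) (i₀ : Fin n),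
    ∀ i j, val x (e i) (e j) = if i = j then (if i = i₀ then -1 else 1) else 0
  contMDiff : ContMDiff (𝓡 n)
    ((𝓡 n).prod 𝓘(ℝ, EuclideanSpace ℝ (Fin n) →L[ℝ] EuclideanSpace ℝ (Fin n) →L[ℝ] ℝ)) ∞
    (fun x ↦ TotalSpace.mk' (EuclideanSpace ℝ (Fin n) →L[ℝ] EuclideanSpace ℝ (Fin n) →L[ℝ] ℝ)
      (E := fun x : M ↦ TangentSpace (𝓡 n) x →L[ℝ] TangentSpace (𝓡 n) x →L[ℝ] ℝ) x (val x))

namespace LorentzMetric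

variable {n : ℕ} {M : Type*} [TopologicalSpace M] [ChartedSpace (EuclideanSpace ℝ (Fin n)) M]
  [IsManifold (𝓡 n) ∞ M] (g : LorentzMetric n M)

/-! ### Raising indices -/

theorem eq_zero_of_forall (x : M) (v : TangentSpace (𝓡 n) x) (h : ∀ w, g.val x v w = 0) :
    v = 0 := by
  obtain ⟨e, i₀, he⟩ := g.signature x
  have hv : ∀ j, e.repr v j = 0 := by
    intro j
    have h1 := h (e j)
    rw [← e.sum_repr v] at h1
    simp only [map_sum, map_smul, _root_.sum_apply, _root_.smul_apply,
      he, smul_eq_mul, mul_ite, mul_zero, Finset.sum_ite_eq', Finset.mem_univ, if_true] at h1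
    split_ifs at h1 <;> simpa using h1
  rw [← e.sum_repr v]
  simp [hv]

/-- Lowering an index, `v ↦ g(v, ·)`, as a linear isomorphism `T_x M ≃ T_x^* M`. -/
def flat (x : M) : TangentSpace (𝓡 n) x ≃ₗ[ℝ] (TangentSpace (𝓡 n) x →L[ℝ] ℝ) :=
  haveI : FiniteDimensional ℝ (TangentSpace (𝓡 n) x) :=
    inferInstanceAs (FiniteDimensional ℝ (EuclideanSpace ℝ (Fin n)))
  haveI : T2Space (TangentSpace (𝓡 n) x) :=
    inferInstanceAs (T2Space (EuclideanSpace ℝ (Fin n)))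
  LinearEquiv.ofInjectiveOfFinrankEq (g.val x : TangentSpace (𝓡 n) x →ₗ[ℝ] _)
    ((injective_iff_map_eq_zero _).2 fun v hv ↦
      g.eq_zero_of_forall x v fun w ↦ congrArg (fun f : TangentSpace (𝓡 n) x →L[ℝ] ℝ ↦ f w) hv)
    ((Subspace.dual_finrank_eq (K := ℝ) (V := TangentSpace (𝓡 n) x)).symm.trans
      (LinearMap.toContinuousLinearMap (𝕜 := ℝ) (E := TangentSpace (𝓡 n) x)
        (F' := ℝ)).finrank_eq)

/-- Raising an index: the vector `α^♯` determined by `g(α^♯, w) = α(w)` for all `w`. -/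
def sharp (x : M) (α : TangentSpace (𝓡 n) x →L[ℝ] ℝ) : TangentSpace (𝓡 n) x :=
  (g.flat x).symm α

theorem val_sharp (x : M) (α : TangentSpace (𝓡 n) x →L[ℝ] ℝ) (w : TangentSpace (𝓡 n) x) :
    g.val x (g.sharp x α) w = α w := by
  have h : g.flat x (g.sharp x α) = α := (g.flat x).apply_symm_apply α
  exact congrArg (fun f : TangentSpace (𝓡 n) x →L[ℝ] ℝ ↦ f w) h

/-- The gradient of a function: `g(grad f, w) = df(w)`. -/
def grad (f : M → ℝ) (x : M) : TangentSpace (𝓡 n) x := g.sharp x (mvfderiv (𝓡 n) f x)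

/-! ### The Levi-Civita connection, through the Koszul formula -/

/-- Differentiability at a point of a vector field, as a section of the tangent bundle. -/
abbrev VFDiffAt (X : Π x : M, TangentSpace (𝓡 n) x) (x : M) : Prop :=
  MDifferentiableAt (𝓡 n) ((𝓡 n).prod 𝓘(ℝ, EuclideanSpace ℝ (Fin n)))
    (fun y ↦ TotalSpace.mk' (EuclideanSpace ℝ (Fin n)) y (X y)) x

theorem mdifferentiableAt_val {X Y : Π x : M, TangentSpace (𝓡 n) x} {x : M}
    (hX : VFDiffAt X x) (hY : VFDiffAt Y x) :
    MDifferentiableAt (𝓡 n) 𝓘(ℝ) (fun y ↦ g.val y (X y) (Y y)) x := by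
  have : MDifferentiableAt (𝓡 n) ((𝓡 n).prod 𝓘(ℝ))
      (fun m ↦ TotalSpace.mk' ℝ (E := Bundle.Trivial M ℝ) m (g.val m (X m) (Y m))) x := by
    apply MDifferentiableAt.clm_bundle_apply₂ (F₁ := EuclideanSpace ℝ (Fin n))
      (F₂ := EuclideanSpace ℝ (Fin n))
    · exact (g.contMDiff x).mdifferentiableAt (by simp)
    · exact hX
    · exact hY
  simp only [mdifferentiableAt_totalSpace] at this
  exact this.2

/-- The right-hand side of the Koszul formula for `2 g(∇_X Y, W)` at `x`. -/
def koszul (X Y W : Π x : M, TangentSpace (𝓡 n) x) (x : M) : ℝ :=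
  mvfderiv (𝓡 n) (fun y ↦ g.val y (Y y) (W y)) x (X x) + mvfderiv (𝓡 n) (fun y ↦ g.val y (X y) (W y)) x (Y x)
    - mvfderiv (𝓡 n) (fun y ↦ g.val y (X y) (Y y)) x (W x)
    + g.val x (mlieBracket (𝓡 n) X Y x) (W x)
    - g.val x (mlieBracket (𝓡 n) X W x) (Y x)
    - g.val x (mlieBracket (𝓡 n) Y W x) (X x)

theorem tensorialAt_koszul_left {Y W : Π x : M, TangentSpace (𝓡 n) x} {x : M}
    (hY : VFDiffAt Y x) (hW : VFDiffAt W x) :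
    TensorialAt (𝓡 n) (EuclideanSpace ℝ (Fin n)) (fun X ↦ g.koszul X Y W x) x where
  smul {f X} hf hX := by
    simp [koszul, mlieBracket_smul_left hf hX,
      mvfderiv_fun_mul hf (g.mdifferentiableAt_val hX hW),
      mvfderiv_fun_mul hf (g.mdifferentiableAt_val hX hY)]
    ring
  add {X X'} hX hX' := by
    simp [koszul, mlieBracket_add_left hX hX',
      mvfderiv_fun_add (g.mdifferentiableAt_val hX hW) (g.mdifferentiableAt_val hX' hW),
      mvfderiv_fun_add (g.mdifferentiableAt_val hX hY) (g.mdifferentiableAt_val hX' hY)]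
    ring

theorem tensorialAt_koszul_right {X Y : Π x : M, TangentSpace (𝓡 n) x} {x : M}
    (hX : VFDiffAt X x) (hY : VFDiffAt Y x) :
    TensorialAt (𝓡 n) (EuclideanSpace ℝ (Fin n)) (fun W ↦ g.koszul X Y W x) x where
  smul {f W} hf hW := by
    simp [koszul, mlieBracket_smul_right hf hW,
      mvfderiv_fun_mul hf (g.mdifferentiableAt_val hX hW),
      mvfderiv_fun_mul hf (g.mdifferentiableAt_val hY hW)]
    rw [g.symm x (W x) (Y x), g.symm x (W x) (X x)]
    ring
  add {W W'} hW hW' := by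
    simp [koszul, mlieBracket_add_right hW hW',
      mvfderiv_fun_add (g.mdifferentiableAt_val hX hW) (g.mdifferentiableAt_val hX hW'),
      mvfderiv_fun_add (g.mdifferentiableAt_val hY hW) (g.mdifferentiableAt_val hY hW')]
    ring

theorem koszul_add {X Y Y' W : Π x : M, TangentSpace (𝓡 n) x} {x : M}
    (hX : VFDiffAt X x) (hY : VFDiffAt Y x) (hY' : VFDiffAt Y' x)
    (hW : VFDiffAt W x) :
    g.koszul X (Y + Y') W x = g.koszul X Y W x + g.koszul X Y' W x := by
  simp [koszul, mlieBracket_add_right hY hY', mlieBracket_add_left hY hY',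
    mvfderiv_fun_add (g.mdifferentiableAt_val hX hY) (g.mdifferentiableAt_val hX hY'),
    mvfderiv_fun_add (g.mdifferentiableAt_val hY hW) (g.mdifferentiableAt_val hY' hW)]
  ring

theorem koszul_smul {X Y W : Π x : M, TangentSpace (𝓡 n) x} {f : M → ℝ} {x : M}
    (hX : VFDiffAt X x) (hY : VFDiffAt Y x) (hf : MDifferentiableAt (𝓡 n) 𝓘(ℝ) f x)
    (hW : VFDiffAt W x) :
    g.koszul X (f • Y) W x
      = f x * g.koszul X Y W x + 2 * (mvfderiv (𝓡 n) f x (X x) * g.val x (Y x) (W x)) := by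
  simp [koszul, mlieBracket_smul_right hf hY, mlieBracket_smul_left hf hY,
    mvfderiv_fun_mul hf (g.mdifferentiableAt_val hX hY),
    mvfderiv_fun_mul hf (g.mdifferentiableAt_val hY hW)]
  rw [g.symm x (Y x) (X x)]
  ring

/-- The index-raising isomorphism as a continuous linear map. -/
def sharpL (x : M) : (TangentSpace (𝓡 n) x →L[ℝ] ℝ) →L[ℝ] TangentSpace (𝓡 n) x :=
  haveI : FiniteDimensional ℝ (TangentSpace (𝓡 n) x) :=
    inferInstanceAs (FiniteDimensional ℝ (EuclideanSpace ℝ (Fin n)))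
  haveI : T2Space (TangentSpace (𝓡 n) x) :=
    inferInstanceAs (T2Space (EuclideanSpace ℝ (Fin n)))
  haveI : FiniteDimensional ℝ (TangentSpace (𝓡 n) x →L[ℝ] ℝ) :=
    (g.flat x).finiteDimensional
  LinearMap.toContinuousLinearMap (g.flat x).symm.toLinearMap

theorem sharpL_apply (x : M) (α : TangentSpace (𝓡 n) x →L[ℝ] ℝ) :
    g.sharpL x α = g.sharp x α := rfl

open Classical in
/-- The covariant derivative `v ↦ ∇_v Y` at `x` of a vector field `Y` differentiable at `x`,
determined by the Koszul formula (and zero by convention when `Y` is not differentiable at `x`). -/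
def leviCivitaAux (Y : Π x : M, TangentSpace (𝓡 n) x) (x : M) :
    TangentSpace (𝓡 n) x →L[ℝ] TangentSpace (𝓡 n) x :=
  if hY : VFDiffAt Y x then
    g.sharpL x ∘L ((1 / 2 : ℝ) • TensorialAt.mkHom₂ (fun X W ↦ g.koszul X Y W x) x
      (fun _ hW ↦ g.tensorialAt_koszul_left hY hW) (fun _ hX ↦ g.tensorialAt_koszul_right hX hY))
  else 0

/-- The Koszul formula. -/
theorem val_leviCivitaAux {X Y W : Π x : M, TangentSpace (𝓡 n) x} {x : M}
    (hX : VFDiffAt X x) (hY : VFDiffAt Y x) (hW : VFDiffAt W x) :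
    g.val x (g.leviCivitaAux Y x (X x)) (W x) = 1 / 2 * g.koszul X Y W x := by
  rw [leviCivitaAux, dif_pos hY, ContinuousLinearMap.comp_apply, sharpL_apply, val_sharp]
  change (1 / 2 : ℝ) * _ = _
  exact congrArg (fun t : ℝ ↦ 1 / 2 * t) (TensorialAt.mkHom₂_apply
    (fun _ hW ↦ g.tensorialAt_koszul_left hY hW) (fun _ hX ↦ g.tensorialAt_koszul_right hX hY)
    hX hW)

theorem ext_of_extend {x : M} {A B : TangentSpace (𝓡 n) x →L[ℝ] TangentSpace (𝓡 n) x}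
    (h : ∀ X W : Π x : M, TangentSpace (𝓡 n) x, VFDiffAt X x → VFDiffAt W x →
      g.val x (A (X x)) (W x) = g.val x (B (X x)) (W x)) : A = B := by
  ext1 v
  rw [← sub_eq_zero]
  apply g.eq_zero_of_forall x
  intro w
  have := h (FiberBundle.extend (EuclideanSpace ℝ (Fin n)) v)
    (FiberBundle.extend (EuclideanSpace ℝ (Fin n)) w)
    (FiberBundle.mdifferentiableAt_extend ..) (FiberBundle.mdifferentiableAt_extend ..)
  simp only [FiberBundle.extend_apply_self] at this
  simp [this]

/-- The Levi-Civita connection of a Lorentzian metric. -/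
def leviCivita : CovariantDerivative (𝓡 n) (EuclideanSpace ℝ (Fin n))
    (TangentSpace (𝓡 n) : M → Type _) where
  toFun := g.leviCivitaAux
  isCovariantDerivativeOnUniv :=
    { add := by
        intro Y Y' x hY hY' _
        apply g.ext_of_extend
        intro X W hX hW
        have hYY : VFDiffAt (Y + Y') x := mdifferentiableAt_add_section hY hY'
        rw [g.val_leviCivitaAux hX hYY hW, g.koszul_add hX hY hY' hW]
        simp only [_root_.add_apply, map_add]
        rw [g.val_leviCivitaAux hX hY hW, g.val_leviCivitaAux hX hY' hW]
        ring
      leibniz := by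
        intro Y f x hY hf _
        apply g.ext_of_extend
        intro X W hX hW
        have hfY : VFDiffAt (f • Y) x := hf.smul_section hY
        rw [g.val_leviCivitaAux hX hfY hW, g.koszul_smul hX hY hf hW]
        simp only [_root_.add_apply, map_add, _root_.smul_apply, map_smul,
          ContinuousLinearMap.smulRight_apply, smul_eq_mul]
        rw [g.val_leviCivitaAux hX hY hW]
        ring }

/-- The Levi-Civita connection is torsion-free. -/
theorem leviCivita_torsion : g.leviCivita.torsion = 0 := by
  rw [CovariantDerivative.torsion_eq_zero_iff]
  intro X Y x hX hY
  rw [← sub_eq_zero]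
  apply g.eq_zero_of_forall x
  intro w
  have hW : VFDiffAt (FiberBundle.extend (EuclideanSpace ℝ (Fin n)) w) x :=
    FiberBundle.mdifferentiableAt_extend ..
  have h1 := g.val_leviCivitaAux hX hY hW
  have h2 := g.val_leviCivitaAux hY hX hW
  have h3 : mlieBracket (𝓡 n) Y X x = - mlieBracket (𝓡 n) X Y x := mlieBracket_swap_apply
  have h4 : (fun y ↦ g.val y (Y y) (X y)) = fun y ↦ g.val y (X y) (Y y) :=
    funext fun y ↦ g.symm y _ _
  simp only [koszul, FiberBundle.extend_apply_self, h3, h4, map_neg, _root_.neg_apply] at h1 h2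
  change g.val x (g.leviCivitaAux Y x (X x) - g.leviCivitaAux X x (Y x) - _) w = 0
  simp only [map_sub, _root_.sub_apply, h1, h2]
  ring

/-- The Levi-Civita connection is compatible with the metric. -/
theorem leviCivita_metric {X Y W : Π x : M, TangentSpace (𝓡 n) x} {x : M}
    (hX : VFDiffAt X x) (hY : VFDiffAt Y x) (hW : VFDiffAt W x) :
    mvfderiv (𝓡 n) (fun y ↦ g.val y (Y y) (W y)) x (X x)
      = g.val x (g.leviCivita Y x (X x)) (W x) + g.val x (Y x) (g.leviCivita W x (X x)) := by
  have h1 := g.val_leviCivitaAux hX hY hW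
  have h2 := g.val_leviCivitaAux hX hW hY
  have h3 : mlieBracket (𝓡 n) W Y x = - mlieBracket (𝓡 n) Y W x := mlieBracket_swap_apply
  have h4 : (fun y ↦ g.val y (W y) (Y y)) = fun y ↦ g.val y (Y y) (W y) :=
    funext fun y ↦ g.symm y _ _
  rw [g.symm x (Y x)]
  change _ = g.val x (g.leviCivitaAux Y x (X x)) (W x) + g.val x (g.leviCivitaAux W x (X x)) (Y x)
  rw [h1, h2]
  simp only [koszul, h3, h4, map_neg, _root_.neg_apply]
  ring

/-! ### Null and covariantly constant vector fields; coordinate vector fields -/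

/-- A vector field is null if at every point it is a nonzero vector `v` with `g(v, v) = 0`
(the zero vector counts as spacelike). -/
def IsNull (Z : Π x : M, TangentSpace (𝓡 n) x) : Prop :=
  ∀ x, Z x ≠ 0 ∧ g.val x (Z x) (Z x) = 0

/-- `∇ Z = 0` for the Levi-Civita connection. -/
def IsCovariantlyConstant (Z : Π x : M, TangentSpace (𝓡 n) x) : Prop :=
  ∀ x, g.leviCivita Z x = 0

end LorentzMetric

/-- The `i`-th coordinate function of a chart. -/
def chartCoord {n : ℕ} {M : Type*} [TopologicalSpace M]
    (φ : OpenPartialHomeomorph M (EuclideanSpace ℝ (Fin n))) (i : Fin n) (x : M) : ℝ := φ x i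

/-- The `i`-th coordinate vector field of a chart: the pullback under the chart of the constant
field `e_i`, so that `dφ (∂_i) = e_i` on the domain of the chart. -/
def coordField {n : ℕ} {M : Type*} [TopologicalSpace M]
    [ChartedSpace (EuclideanSpace ℝ (Fin n)) M]
    (φ : OpenPartialHomeomorph M (EuclideanSpace ℝ (Fin n))) (i : Fin n) (x : M) :
    TangentSpace (𝓡 n) x :=
  mpullback (𝓡 n) (𝓡 n) φ
    (fun y ↦ (NormedSpace.fromTangentSpace y).symm (EuclideanSpace.single i (1 : ℝ))) x

end

/-
Since `∇` is torsion-free and metric, `∇Z = 0` makes the one-form `Z♭ = g(Z, ·)` closed, so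
`Z♭ = du` near `p` by the Poincaré lemma, that is, `Z = grad u`; and `du(Z) = g(Z, Z) = 0` because
`Z` is null. As `Z p` and `du p` are nonzero, this forces `n ≥ 2`.

Straighten `Z` by its flow. The flow is smooth in time and initial point by the inverse function
theorem: after rescaling time to `[0, 1]`, the orbit through `x` solves
`γ(s) = x + t ∫₀ˢ f(γ)` in the Banach space `C([0, 1], E)`, where postcomposition with a smooth `f`
is smooth.
In the straightened coordinates `Z` is constant and `u` does not vary along it, so after a linear
change of coordinates `u` can replace the first coordinate without changing `Z = ∂_v`.
-/

open Set Filter Topology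

section InverseFunction

variable {𝕜 : Type*} [RCLike 𝕜] {E F : Type*} [NormedAddCommGroup E] [NormedSpace 𝕜 E]
  [CompleteSpace E] [NormedAddCommGroup F] [NormedSpace 𝕜 F]

/- `toOpenPartialHomeomorph` only gives a local inverse that is smooth at the image of `a`;
shrinking to the open set where the derivative is invertible makes it smooth on its whole domain. -/
theorem exists_openPartialHomeomorph_of_contDiffOn {m : WithTop ℕ∞} (hm : m ≠ 0) {f : E → F}
    {U : Set E} (hU : IsOpen U) (hf : ContDiffOn 𝕜 m f U) {a : E} (ha : a ∈ U) {A : E ≃L[𝕜] F}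
    (hA : HasFDerivAt f (A : E →L[𝕜] F) a) :
    ∃ e : OpenPartialHomeomorph E F, ⇑e = f ∧ a ∈ e.source ∧ e.source ⊆ U ∧
      ContDiffOn 𝕜 m e.symm e.target ∧
      ∀ x ∈ e.source, ∃ B : E ≃L[𝕜] F, HasFDerivAt e (B : E →L[𝕜] F) x := by
  have hfU : ∀ x ∈ U, ContDiffAt 𝕜 m f x := fun x hx ↦ hf.contDiffAt (hU.mem_nhds hx)
  let V := U ∩ fderiv 𝕜 f ⁻¹' range ((↑) : (E ≃L[𝕜] F) → E →L[𝕜] F)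
  have hV : IsOpen V := (hf.continuousOn_fderiv_of_isOpen hU
    (ENat.one_le_iff_ne_zero_withTop.2 hm)).isOpen_inter_preimage hU ContinuousLinearEquiv.isOpen
  have hderiv : ∀ x ∈ V, ∃ B : E ≃L[𝕜] F, HasFDerivAt f (B : E →L[𝕜] F) x := by
    rintro x ⟨hx, B, hB⟩
    exact ⟨B, hB ▸ ((hfU x hx).differentiableAt hm).hasFDerivAt⟩
  let e := ((hfU a ha).toOpenPartialHomeomorph f hA hm).restrOpen V hV
  have heV : e.source ⊆ V := inter_subset_right
  refine ⟨e, rfl, ⟨(hfU a ha).mem_toOpenPartialHomeomorph_source hA hm, ha, A, hA.fderiv.symm⟩,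
    heV.trans inter_subset_left, fun y hy ↦ ?_, fun x hx ↦ hderiv x (heV hx)⟩
  have hx := heV (e.map_target hy)
  obtain ⟨B, hB⟩ := hderiv _ hx
  exact (e.contDiffAt_symm hy hB (hfU _ hx.1)).contDiffWithinAt

end InverseFunction

section FixedPoint

variable {𝕜 : Type*} [RCLike 𝕜] {X : Type*} [NormedAddCommGroup X] [NormedSpace 𝕜 X]
  [CompleteSpace X]

theorem exists_contDiffOn_eq_add_smul {m : WithTop ℕ∞} (hm : m ≠ 0) {N : X → X}
    (hN : ContDiff 𝕜 m N) (a : X) :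
    ∃ (Γ : 𝕜 × X → X) (V : Set (𝕜 × X)), IsOpen V ∧ (0, a) ∈ V ∧ ContDiffOn 𝕜 m Γ V ∧
      ∀ z ∈ V, Γ z = z.2 + z.1 • N (Γ z) ∧
        ∀ δ, δ = N (Γ z) + z.1 • fderiv 𝕜 N (Γ z) δ → fderiv 𝕜 Γ z (1, 0) = δ := by
  let G : 𝕜 × X → 𝕜 × X := fun z ↦ (z.1, z.2 - z.1 • N z.2)
  have hG : ContDiff 𝕜 m G :=
    contDiff_fst.prodMk (contDiff_snd.sub (contDiff_fst.smul (hN.comp contDiff_snd)))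
  have hGd : ∀ z, HasFDerivAt G ((ContinuousLinearMap.fst 𝕜 𝕜 X).prod
      (.snd 𝕜 𝕜 X - (z.1 • fderiv 𝕜 N z.2 ∘L .snd 𝕜 𝕜 X +
        (ContinuousLinearMap.fst 𝕜 𝕜 X).smulRight (N z.2)))) z := fun z ↦
    hasFDerivAt_fst.prodMk (hasFDerivAt_snd.sub (hasFDerivAt_fst.smul
      (((hN.differentiable hm) z.2).hasFDerivAt.comp z hasFDerivAt_snd)))
  let A : (𝕜 × X) ≃L[𝕜] (𝕜 × X) := (ContinuousLinearEquiv.refl 𝕜 𝕜).skewProd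
    (ContinuousLinearEquiv.refl 𝕜 X) (-ContinuousLinearMap.toSpanSingleton 𝕜 (N a))
  have hA : HasFDerivAt G (A : 𝕜 × X →L[𝕜] 𝕜 × X) (0, a) :=
    (hGd _).congr_fderiv (by ext <;> simp [A])
  obtain ⟨e, he, ha, -, hsymm, hinv⟩ :=
    exists_openPartialHomeomorph_of_contDiffOn hm isOpen_univ hG.contDiffOn (mem_univ _) hA
  have hval : ∀ z ∈ e.target, G (e.symm z) = z := fun z hz ↦ he ▸ e.right_inv hz
  have hfst : ∀ z ∈ e.target, (e.symm z).1 = z.1 := fun z hz ↦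
    show (G (e.symm z)).1 = z.1 by rw [hval z hz]
  refine ⟨fun z ↦ (e.symm z).2, e.target, e.open_target, ?_, contDiff_snd.comp_contDiffOn hsymm,
    fun z hz ↦ ⟨?_, fun δ hδ ↦ ?_⟩⟩
  · simpa [he, G] using e.map_source ha
  · rw [← sub_eq_iff_eq_add, ← hfst z hz]
    exact congrArg Prod.snd (hval z hz)
  · obtain ⟨B, hB⟩ := hinv _ (e.map_target hz)
    have hBδ : B (1, δ) = (1, 0) := by
      rw [he] at hB
      rw [← ContinuousLinearEquiv.coe_coe, hB.unique (hGd _), hfst z hz]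
      simpa [sub_eq_zero, add_comm] using hδ
    rw [(e.hasFDerivAt_symm hz hB).snd.fderiv]
    simp [← hBδ]

end FixedPoint

section Postcomp

universe u

variable {K E F : Type*} [TopologicalSpace K] [CompactSpace K]
  [NormedAddCommGroup E] [NormedSpace ℝ E] [NormedAddCommGroup F] [NormedSpace ℝ F]

set_option synthInstance.maxHeartbeats 100000 in
-- a shortcut: instance search reaches this only beyond the default limit
noncomputable local instance : NormedAddCommGroup C(K, E →L[ℝ] F) := inferInstance

/-- The continuous bilinear map `(A, h) ↦ (k ↦ A k (h k))`, through which the derivative of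
postcomposition is expressed. -/
noncomputable def pointwiseApply : C(K, E →L[ℝ] F) →L[ℝ] C(K, E) →L[ℝ] C(K, F) :=
  LinearMap.mkContinuous₂
    (LinearMap.mk₂ ℝ (fun (A : C(K, E →L[ℝ] F)) (h : C(K, E)) ↦
        (⟨fun k ↦ A k (h k), by fun_prop⟩ : C(K, F)))
      (fun _ _ _ ↦ by ext; simp) (fun _ _ _ ↦ by ext; simp)
      (fun _ _ _ ↦ by ext; simp) (fun _ _ _ ↦ by ext; simp)) 1
    (fun A h ↦ by
      rw [one_mul, ContinuousMap.norm_le _ (by positivity)]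
      exact fun k ↦ (A k).le_of_opNorm_le_of_le (A.norm_coe_le_norm k) (h.norm_coe_le_norm k))

@[simp]
theorem pointwiseApply_apply (A : C(K, E →L[ℝ] F)) (h : C(K, E)) (k : K) :
    pointwiseApply A h k = A k (h k) := rfl

theorem hasFDerivAt_postcomp {f : C(E, F)} {f' : C(E, E →L[ℝ] F)}
    (hf : ∀ x, HasFDerivAt f (f' x) x) (γ : C(K, E)) :
    HasFDerivAt (fun γ : C(K, E) ↦ f.comp γ) (pointwiseApply (f'.comp γ)) γ := by
  rw [hasFDerivAt_iff_isLittleO_nhds_zero, Asymptotics.isLittleO_iff]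
  intro ε hε
  obtain ⟨δ, hδ, hball⟩ := (Metric.continuous_iff (β := C(K, E →L[ℝ] F))).1
    (ContinuousMap.continuous_postcomp (X := K) f') γ ε hε
  filter_upwards [Metric.ball_mem_nhds (0 : C(K, E)) hδ] with h hh
  rw [mem_ball_zero_iff] at hh
  rw [ContinuousMap.norm_le _ (by positivity)]
  intro k
  have hf'k : ∀ y ∈ Metric.ball (γ k) δ, ‖f' y - f' (γ k)‖ ≤ ε := by
    intro y hy
    -- translate `γ` by a constant so that it passes through `y`
    have hdist : dist (γ + ContinuousMap.const K (y - γ k)) γ < δ := by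
      rw [dist_eq_norm, add_sub_cancel_left]
      refine lt_of_le_of_lt ?_ (mem_ball_iff_norm.1 hy)
      exact (ContinuousMap.norm_le _ (norm_nonneg _)).2 fun _ ↦ le_rfl
    simpa [dist_eq_norm] using
      (ContinuousMap.dist_apply_le_dist k).trans (hball _ hdist).le
  have hk : ‖h k‖ ≤ ‖h‖ := h.norm_coe_le_norm k
  have hmvt := (convex_ball (γ k) δ).norm_image_sub_le_of_norm_hasFDerivWithin_le'
    (y := γ k + h k) (fun y _ ↦ (hf y).hasFDerivWithinAt) hf'k (Metric.mem_ball_self hδ)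
    (by simpa [mem_ball_iff_norm] using hk.trans_lt hh)
  calc _ ≤ ε * ‖h k‖ := by simpa using hmvt
    _ ≤ ε * ‖h‖ := by gcongr

theorem contDiff_nat_postcomp {E : Type u} [NormedAddCommGroup E] [NormedSpace ℝ E] (m : ℕ) :
    ∀ {F : Type u} [NormedAddCommGroup F] [NormedSpace ℝ F] {f : C(E, F)}, ContDiff ℝ m f →
      ContDiff ℝ m (fun γ : C(K, E) ↦ f.comp γ) := by
  induction m with
  | zero => exact fun {_ _ _ f} _ ↦ contDiff_zero.2 (ContinuousMap.continuous_postcomp f)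
  | succ m ih =>
    intro F _ _ f hf
    rw [Nat.cast_succ, contDiff_succ_iff_hasFDerivAt] at hf ⊢
    obtain ⟨f', hf', hff'⟩ := hf
    exact ⟨_, pointwiseApply.contDiff.comp (ih (f := ⟨f', hf'.continuous⟩) hf'),
      hasFDerivAt_postcomp (f' := ⟨f', hf'.continuous⟩) hff'⟩

theorem contDiff_postcomp {E F : Type u} [NormedAddCommGroup E] [NormedSpace ℝ E]
    [NormedAddCommGroup F] [NormedSpace ℝ F] {m : ℕ∞} {f : C(E, F)} (hf : ContDiff ℝ m f) :
    ContDiff ℝ m (fun γ : C(K, E) ↦ f.comp γ) :=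
  contDiff_iff_forall_nat_le.2 fun k hk ↦
    contDiff_nat_postcomp k (hf.of_le (by exact_mod_cast hk))

end Postcomp

section Primitive

variable {E : Type*} [NormedAddCommGroup E] [NormedSpace ℝ E]

/-- The operator `c ↦ (s ↦ ∫₀ˢ c)` on continuous curves `[0, 1] → E`, used to turn ordinary
differential equations into integral equations. -/
noncomputable def primitive : C(unitInterval, E) →L[ℝ] C(unitInterval, E) :=
  have hint (c : C(unitInterval, E)) (a b : ℝ) :
      IntervalIntegrable (IccExtend zero_le_one c) MeasureTheory.volume a b :=
    (c.continuous.Icc_extend' (h := zero_le_one)).intervalIntegrable a b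
  LinearMap.mkContinuous
    { toFun c := ⟨fun s ↦ ∫ r in (0 : ℝ)..s, IccExtend zero_le_one c r,
        (intervalIntegral.continuous_primitive (hint c) 0).comp continuous_subtype_val⟩
      map_add' c₁ c₂ := by
        ext s
        exact intervalIntegral.integral_add (hint c₁ 0 s) (hint c₂ 0 s)
      map_smul' a c := by
        ext s
        exact intervalIntegral.integral_smul a _ } 1
    (fun c ↦ by
      rw [one_mul, ContinuousMap.norm_le _ (norm_nonneg _)]
      intro s
      calc ‖∫ r in (0 : ℝ)..s, IccExtend zero_le_one c r‖ ≤ ‖c‖ * |(s : ℝ) - 0| :=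
            intervalIntegral.norm_integral_le_of_norm_le_const fun _ _ ↦ c.norm_coe_le_norm _
        _ ≤ ‖c‖ * 1 := by
            gcongr
            rw [sub_zero, abs_of_nonneg s.2.1]
            exact s.2.2
        _ = ‖c‖ := mul_one _)

theorem primitive_apply (c : C(unitInterval, E)) (s : unitInterval) :
    primitive c s = ∫ r in (0 : ℝ)..s, IccExtend zero_le_one c r := rfl

variable [CompleteSpace E]

theorem hasDerivAt_integral_IccExtend (c : C(unitInterval, E)) (s : unitInterval) :
    HasDerivAt (fun σ : ℝ ↦ ∫ r in (0 : ℝ)..σ, IccExtend zero_le_one c r) (c s) s := by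
  have h := ((c.continuous.Icc_extend' (h := zero_le_one)).integral_hasStrictDerivAt 0 s).hasDerivAt
  rwa [IccExtend_of_mem _ _ s.2] at h

theorem primitive_eq_sub {c : C(unitInterval, E)} {h : ℝ → E}
    (hd : ∀ s : unitInterval, HasDerivAt h (c s) s) (s : unitInterval) :
    primitive c s = h s - h 0 := by
  rw [primitive_apply]
  refine intervalIntegral.integral_eq_sub_of_hasDerivAt (fun r hr ↦ ?_)
    (c.continuous.Icc_extend'.intervalIntegrable 0 s)
  rw [uIcc_of_le s.2.1] at hr
  have hr' : r ∈ Icc (0 : ℝ) 1 := ⟨hr.1, hr.2.trans s.2.2⟩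
  rw [IccExtend_of_mem _ _ hr']
  exact hd ⟨r, hr'⟩

/- If `γ` solves `γ' = t f(γ)`, then `s ↦ s f(γ s)` is the derivative of `γ` with respect to the
parameter `t`, since `γ s` is the flow of `f` at time `s t`; this is the integrated form of the
linearised equation which it satisfies. -/
theorem variation_eq_primitive_add_smul {f : C(E, E)} {f' : C(E, E →L[ℝ] E)}
    (hf : ∀ x, HasFDerivAt f (f' x) x) {x : E} {t : ℝ} {γ δ : C(unitInterval, E)}
    (hγ : γ = ContinuousMap.const _ x + t • primitive (f.comp γ))
    (hδ : ∀ s : unitInterval, δ s = (s : ℝ) • f (γ s)) :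
    δ = primitive (f.comp γ) + t • primitive (pointwiseApply (f'.comp γ) δ) := by
  let γ' : ℝ → E := fun σ ↦ x + t • ∫ r in (0 : ℝ)..σ, IccExtend zero_le_one (f.comp γ) r
  have hγ' : ∀ s : unitInterval, γ' s = γ s := fun s ↦ (congrArg (· s) hγ).symm
  have hγ'd : ∀ s : unitInterval, HasDerivAt γ' (t • f (γ s)) s := fun s ↦
    ((hasDerivAt_integral_IccExtend (f.comp γ) s).const_smul t).const_add x
  have hd : ∀ s : unitInterval, HasDerivAt (fun σ : ℝ ↦ σ • f (γ' σ))
      ((f.comp γ + t • pointwiseApply (f'.comp γ) δ) s) s := by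
    intro s
    have hfγ : HasDerivAt (fun σ ↦ f (γ' σ)) (f' (γ s) (t • f (γ s))) s :=
      (hf (γ s)).comp_hasDerivAt_of_eq (s : ℝ) (hγ'd s) (hγ' s).symm
    refine ((hasDerivAt_id' (s : ℝ)).smul hfγ).congr_deriv ?_
    simp [hγ', hδ, smul_comm t (s : ℝ), add_comm]
  ext s
  rw [← map_smul, ← map_add, primitive_eq_sub hd, hδ, hγ']
  simp

end Primitive

section Flow

universe u

variable {E : Type u} [NormedAddCommGroup E] [NormedSpace ℝ E] [CompleteSpace E]

theorem exists_contDiffOn_flow {m : ℕ∞} (hm : m ≠ 0) {f : E → E} (hf : ContDiff ℝ m f) (p : E) :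
    ∃ (Φ : ℝ × E → E) (V : Set (ℝ × E)), IsOpen V ∧ (0, p) ∈ V ∧ ContDiffOn ℝ m Φ V ∧
      (∀ x, (0, x) ∈ V → Φ (0, x) = x) ∧ ∀ z ∈ V, fderiv ℝ Φ z (1, 0) = f (Φ z) := by
  have hm' : (m : WithTop ℕ∞) ≠ 0 := by exact_mod_cast hm
  let f₀ : C(E, E) := ⟨f, hf.continuous⟩
  let f₁ : C(E, E →L[ℝ] E) := ⟨fderiv ℝ f, hf.continuous_fderiv hm'⟩
  have hf₁ : ∀ x, HasFDerivAt f₀ (f₁ x) x := fun x ↦ (hf.differentiable hm' x).hasFDerivAt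
  let N : C(unitInterval, E) → C(unitInterval, E) := fun γ ↦ primitive (f₀.comp γ)
  have hN : ContDiff ℝ m N := primitive.contDiff.comp (contDiff_postcomp (f := f₀) hf)
  have hNd : ∀ γ, fderiv ℝ N γ = primitive ∘L pointwiseApply (f₁.comp γ) := fun γ ↦
    ((primitive (E := E)).hasFDerivAt.comp γ (hasFDerivAt_postcomp hf₁ γ)).fderiv
  obtain ⟨Γ, V, hV, hpV, hΓ, hΓV⟩ :=
    exists_contDiffOn_eq_add_smul hm' hN (ContinuousMap.const _ p)
  let ι : ℝ × E →L[ℝ] ℝ × C(unitInterval, E) :=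
    (ContinuousLinearMap.id ℝ ℝ).prodMap (ContinuousLinearMap.const ℝ _)
  let ev : C(unitInterval, E) →L[ℝ] E := ContinuousMap.evalCLM ℝ 1
  refine ⟨ev ∘ Γ ∘ ι, ι ⁻¹' V, hV.preimage ι.continuous, hpV,
    ev.contDiff.comp_contDiffOn (hΓ.comp ι.contDiff.contDiffOn fun _ hz ↦ hz), ?_, ?_⟩
  · intro x hx
    exact (congrArg ev (hΓV (ι (0, x)) hx).1).trans (by simp [ι, ev])
  · intro z hz
    let δ : C(unitInterval, E) := ⟨fun s ↦ (s : ℝ) • f (Γ (ι z) s), by fun_prop⟩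
    have hδ : fderiv ℝ Γ (ι z) (1, 0) = δ := (hΓV _ hz).2 δ <| by
      rw [hNd]
      exact variation_eq_primitive_add_smul hf₁ (hΓV _ hz).1 fun _ ↦ rfl
    have hΓd := ((hΓ.contDiffAt (hV.mem_nhds hz)).differentiableAt hm').hasFDerivAt
    rw [(ev.hasFDerivAt.comp z (hΓd.comp z ι.hasFDerivAt)).fderiv]
    have hι : ι (1, 0) = (1, 0) := by simp [ι]
    simp [hι, hδ, δ, ev]

end Flow

section Straightening

variable {E : Type*} [NormedAddCommGroup E] [NormedSpace ℝ E]

theorem exists_contDiff_eventuallyEq [HasContDiffBump E] {F : Type*} [NormedAddCommGroup F]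
    [NormedSpace ℝ F] {m : ℕ∞} {f : E → F} {U : Set E} (hU : IsOpen U) (hf : ContDiffOn ℝ m f U)
    {p : E} (hp : p ∈ U) : ∃ f' : E → F, ContDiff ℝ m f' ∧ f' =ᶠ[𝓝 p] f := by
  obtain ⟨r, hr, hball⟩ := Metric.isOpen_iff.1 hU p hp
  let χ : ContDiffBump p := ⟨r / 4, r / 2, by positivity, by linarith⟩
  refine ⟨fun x ↦ χ x • f x, contDiff_iff_contDiffAt.2 fun x ↦ ?_, ?_⟩
  · by_cases hx : x ∈ U
    · exact χ.contDiffAt.smul (hf.contDiffAt (hU.mem_nhds hx))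
    · have hxr : x ∈ (Metric.closedBall p (r / 2))ᶜ := fun h ↦
        hx (hball (Metric.closedBall_subset_ball (by linarith) h))
      refine (contDiffAt_const (c := (0 : F))).congr_of_eventuallyEq ?_
      filter_upwards [Metric.isClosed_closedBall.isOpen_compl.mem_nhds hxr] with y hy
      rw [χ.zero_of_le_dist (not_le.1 fun h ↦ hy h).le, zero_smul]
  · filter_upwards [χ.eventuallyEq_one] with x hx
    simp [hx]

variable [CompleteSpace E]

theorem exists_hasFDerivAt_id_and_fderiv_apply_eq {m : ℕ∞} (hm : m ≠ 0) {f : E → E}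
    (hf : ContDiff ℝ m f) {p : E} (hfp : f p ≠ 0) :
    ∃ (Θ : E → E) (V : Set E), IsOpen V ∧ p ∈ V ∧ ContDiffOn ℝ m Θ V ∧ Θ p = p ∧
      HasFDerivAt Θ (ContinuousLinearMap.id ℝ E) p ∧ ∀ y ∈ V, fderiv ℝ Θ y (f p) = f (Θ y) := by
  have hm' : (m : WithTop ℕ∞) ≠ 0 := by exact_mod_cast hm
  obtain ⟨Φ, V, hV, hpV, hΦ, hΦ₀, hΦf⟩ := exists_contDiffOn_flow hm hf p
  have hΦd : ∀ z ∈ V, HasFDerivAt Φ (fderiv ℝ Φ z) z := fun z hz ↦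
    ((hΦ.contDiffAt (hV.mem_nhds hz)).differentiableAt hm').hasFDerivAt
  have hΦp : ∀ w, fderiv ℝ Φ (0, p) (0, w) = w := by
    have hι : HasFDerivAt (fun x : E ↦ ((0 : ℝ), x)) (.inr ℝ ℝ E) p :=
      hasFDerivAt_prodMk_right 0 p
    have hid : (fun x ↦ Φ (0, x)) =ᶠ[𝓝 p] id :=
      (hι.continuousAt.eventually (hV.mem_nhds hpV)).mono hΦ₀
    exact DFunLike.congr_fun
      (((hΦd _ hpV).comp p hι).unique ((hasFDerivAt_id p).congr_of_eventuallyEq hid))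
  -- `κ` splits off the time coordinate: `Φ ∘ κ` flows from the hyperplane `p + ker ℓ`.
  obtain ⟨ℓ, hℓ⟩ := SeparatingDual.exists_eq_one (R := ℝ) hfp
  let κ' : E →L[ℝ] ℝ × E := ℓ.prod (.id ℝ E - ℓ.smulRight (f p))
  have hκ'f : κ' (f p) = (1, 0) := by simp [κ', hℓ]
  let κ : E → ℝ × E := fun y ↦ κ' y + ((0, p) - κ' p)
  have hκ : ContDiff ℝ m κ := κ'.contDiff.add contDiff_const
  have hκp : κ p = (0, p) := by simp [κ]
  have hΘd : ∀ y ∈ κ ⁻¹' V, HasFDerivAt (Φ ∘ κ) (fderiv ℝ Φ (κ y) ∘L κ') y := fun y hy ↦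
    (hΦd _ hy).comp y (κ'.hasFDerivAt.add_const _)
  have hΘp : (Φ ∘ κ) p = p := by rw [Function.comp_apply, hκp, hΦ₀ p hpV]
  have hpκ : p ∈ κ ⁻¹' V := by rwa [mem_preimage, hκp]
  refine ⟨Φ ∘ κ, κ ⁻¹' V, hV.preimage hκ.continuous, hpκ,
    hΦ.comp hκ.contDiffOn fun _ hy ↦ hy, hΘp, ?_, fun y hy ↦ ?_⟩
  · refine (hΘd p hpκ).congr_fderiv (ContinuousLinearMap.ext fun w ↦ ?_)
    have hκ'w : κ' w = ℓ w • (1, 0) + (0, w - ℓ w • f p) := by simp [κ']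
    rw [hκp, ContinuousLinearMap.comp_apply, hκ'w, map_add, map_smul, hΦp, hΦf _ hpV, hΦ₀ p hpV]
    simp
  · rw [(hΘd y hy).fderiv, ContinuousLinearMap.comp_apply, hκ'f, hΦf _ hy, Function.comp_apply]

theorem exists_fderiv_apply_eq_const [HasContDiffBump E] {m : ℕ∞} (hm : m ≠ 0) {f : E → E}
    {U : Set E} (hU : IsOpen U) (hf : ContDiffOn ℝ m f U) {p : E} (hp : p ∈ U) (hfp : f p ≠ 0) :
    ∃ (Ξ : E → E) (V : Set E), IsOpen V ∧ p ∈ V ∧ V ⊆ U ∧ ContDiffOn ℝ m Ξ V ∧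
      HasFDerivAt Ξ (ContinuousLinearMap.id ℝ E) p ∧ ∀ x ∈ V, fderiv ℝ Ξ x (f x) = f p := by
  obtain ⟨f', hf', hff'⟩ := exists_contDiff_eventuallyEq hU hf hp
  obtain ⟨W, hWU, hW, hpW⟩ := mem_nhds_iff.1 (inter_mem hff' (hU.mem_nhds hp))
  have hf'p : f' p = f p := hff'.self_of_nhds
  obtain ⟨Θ, V, hV, hpV, hΘ, hΘp, hΘd, hΘf⟩ :=
    exists_hasFDerivAt_id_and_fderiv_apply_eq hm hf' (hf'p ▸ hfp)
  obtain ⟨e, rfl, hpe, heV, hsymm, hinv⟩ := exists_openPartialHomeomorph_of_contDiffOn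
    (by exact_mod_cast hm) hV hΘ hpV (A := .refl ℝ E) hΘd
  have hpt : p ∈ e.target := hΘp ▸ e.map_source hpe
  have hep : e.symm p = p := (congrArg e.symm hΘp.symm).trans (e.left_inv hpe)
  refine ⟨e.symm, e.target ∩ W, e.open_target.inter hW, ⟨hpt, hpW⟩, fun x hx ↦ (hWU hx.2).2,
    hsymm.mono inter_subset_left, ?_, fun x hx ↦ ?_⟩
  · exact e.hasFDerivAt_symm (f' := .refl ℝ E) hpt (hep.symm ▸ hΘd)
  · have hy := e.map_target hx.1
    obtain ⟨B, hB⟩ := hinv _ hy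
    have hBf : B (f p) = f x := by
      have h := hΘf _ (heV hy)
      rwa [hB.fderiv, e.right_inv hx.1, hf'p, (hWU hx.2).1] at h
    rw [(e.hasFDerivAt_symm hx.1 hB).fderiv]
    exact (B.symm_apply_eq).2 hBf.symm

end Straightening

section NormalForm

theorem two_le_finrank_of_apply_eq_zero {K V : Type*} [Field K] [AddCommGroup V] [Module K V]
    [FiniteDimensional K V] {α : Module.Dual K V} (hα : α ≠ 0) {v : V} (hv : v ≠ 0)
    (hαv : α v = 0) : 2 ≤ Module.finrank K V := by
  have hker : 0 < Module.finrank K α.ker :=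
    Module.finrank_pos_iff_exists_ne_zero.2 ⟨⟨v, hαv⟩, fun h ↦ hv (congrArg Subtype.val h)⟩
  rw [← Module.Dual.finrank_ker_add_one_of_ne_zero hα]
  lia

variable {𝕜 : Type*} [RCLike 𝕜] {E F : Type*} [NormedAddCommGroup E] [NormedSpace 𝕜 E]
  [FiniteDimensional 𝕜 E] [NormedAddCommGroup F] [NormedSpace 𝕜 F] [FiniteDimensional 𝕜 F]

theorem exists_continuousLinearEquiv_ker_apply_eq
    (hEF : Module.finrank 𝕜 E = Module.finrank 𝕜 F) {α : E →L[𝕜] 𝕜} {β : F →L[𝕜] 𝕜} (hα : α ≠ 0)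
    (hβ : β ≠ 0) {v : α.ker} {w : β.ker} (hv : v ≠ 0) (hw : w ≠ 0) :
    ∃ T : α.ker ≃L[𝕜] β.ker, T v = w := by
  have hα' : (α : E →ₗ[𝕜] 𝕜) ≠ 0 := by exact_mod_cast hα
  have hβ' : (β : F →ₗ[𝕜] 𝕜) ≠ 0 := by exact_mod_cast hβ
  have hker : Module.finrank 𝕜 α.ker = Module.finrank 𝕜 β.ker := by
    have h₁ := Module.Dual.finrank_ker_add_one_of_ne_zero hα'
    have h₂ := Module.Dual.finrank_ker_add_one_of_ne_zero hβ'
    lia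
  let T₁ := ContinuousLinearEquiv.ofFinrankEq hker
  obtain ⟨T₂, hT₂⟩ := SeparatingDual.exists_continuousLinearEquiv_apply_eq (R := 𝕜)
    (T₁.map_ne_zero_iff.2 hv) hw
  exact ⟨T₁.trans T₂, hT₂⟩

theorem exists_continuousLinearEquiv_apply_eq_and_comp_eq
    (hEF : Module.finrank 𝕜 E = Module.finrank 𝕜 F) {α : E →L[𝕜] 𝕜} {β : F →L[𝕜] 𝕜} (hα : α ≠ 0)
    (hβ : β ≠ 0) {v : E} {w : F} (hv : v ≠ 0) (hw : w ≠ 0) (hαv : α v = 0) (hβw : β w = 0) :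
    ∃ L : E ≃L[𝕜] F, L v = w ∧ β ∘L (L : E →L[𝕜] F) = α := by
  obtain ⟨x, hx⟩ := LinearMap.surjective (f := (α : E →ₗ[𝕜] 𝕜)) (by exact_mod_cast hα) 1
  obtain ⟨y, hy⟩ := LinearMap.surjective (f := (β : F →ₗ[𝕜] 𝕜)) (by exact_mod_cast hβ) 1
  obtain ⟨T, hT⟩ := exists_continuousLinearEquiv_ker_apply_eq hEF hα hβ (v := ⟨v, hαv⟩)
    (w := ⟨w, hβw⟩) (fun h ↦ hv (congrArg Subtype.val h)) fun h ↦ hw (congrArg Subtype.val h)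
  let S₁ := ContinuousLinearEquiv.equivOfRightInverse α (.toSpanSingleton 𝕜 x)
    fun c ↦ by simpa using congrArg (c * ·) hx
  let S₂ := ContinuousLinearEquiv.equivOfRightInverse β (.toSpanSingleton 𝕜 y)
    fun c ↦ by simpa using congrArg (c * ·) hy
  refine ⟨S₁.trans (((ContinuousLinearEquiv.refl 𝕜 𝕜).prodCongr T).trans S₂.symm), ?_, ?_⟩
  · have hS₁ : S₁ v = (0, ⟨v, hαv⟩) := Prod.ext hαv (Subtype.ext (by simp [S₁, hαv]))
    simp [hS₁, hT, S₂]
  · ext z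
    have hβS₂ : ∀ a, β (S₂.symm a) = a.1 := fun a ↦
      congrArg Prod.fst (S₂.apply_symm_apply a)
    simp [hβS₂, S₁]

end NormalForm

section AdaptedCoordinates

variable {E F : Type*} [NormedAddCommGroup E] [NormedSpace ℝ E] [FiniteDimensional ℝ E]
  [NormedAddCommGroup F] [NormedSpace ℝ F] [FiniteDimensional ℝ F]

theorem exists_adapted_openPartialHomeomorph {m : ℕ∞} (hm : m ≠ 0)
    (hEF : Module.finrank ℝ E = Module.finrank ℝ F) {β : F →L[ℝ] ℝ} {w : F} (hβ : β ≠ 0)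
    (hw : w ≠ 0) (hβw : β w = 0) {f : E → E} {u : E → ℝ} {U : Set E} (hU : IsOpen U)
    (hf : ContDiffOn ℝ m f U) (hu : ContDiffOn ℝ m u U) (huf : ∀ x ∈ U, fderiv ℝ u x (f x) = 0)
    {p : E} (hp : p ∈ U) (hfp : f p ≠ 0) (hup : fderiv ℝ u p ≠ 0) :
    ∃ e : OpenPartialHomeomorph E F, p ∈ e.source ∧ e.source ⊆ U ∧ ContDiffOn ℝ m e e.source ∧
      ContDiffOn ℝ m e.symm e.target ∧ (∀ x, β (e x) = u x) ∧
      ∀ x ∈ e.source, fderiv ℝ e x (f x) = w := by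
  have hm' : (m : WithTop ℕ∞) ≠ 0 := by exact_mod_cast hm
  have : CompleteSpace E := FiniteDimensional.complete ℝ E
  obtain ⟨Ξ, V, hV, hpV, hVU, hΞ, hΞp, hΞf⟩ := exists_fderiv_apply_eq_const hm hU hf hp hfp
  obtain ⟨L, hLf, hLu⟩ :=
    exists_continuousLinearEquiv_apply_eq_and_comp_eq hEF hup hβ hfp hw (huf p hp) hβw
  obtain ⟨y, hy⟩ := LinearMap.surjective (f := (β : F →ₗ[ℝ] ℝ)) (by exact_mod_cast hβ) 1
  have hβy : β y = 1 := hy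
  -- correct `L ∘ Ξ` in the direction `y` so that its `β`-coordinate becomes `u`
  let G : E → F := fun x ↦ L (Ξ x) + (u x - β (L (Ξ x))) • y
  have huV := hu.mono hVU
  have hLΞ : ContDiffOn ℝ m (fun x ↦ L (Ξ x)) V := L.contDiff.comp_contDiffOn hΞ
  have hG : ContDiffOn ℝ m G V :=
    hLΞ.add ((huV.sub (β.contDiff.comp_contDiffOn hLΞ)).smul contDiffOn_const)
  have hGd : ∀ x ∈ V, HasFDerivAt G ((L : E →L[ℝ] F) ∘L fderiv ℝ Ξ x +
      (fderiv ℝ u x - β ∘L (L : E →L[ℝ] F) ∘L fderiv ℝ Ξ x).smulRight y) x := by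
    intro x hx
    have hLΞx := L.hasFDerivAt.comp x
      ((hΞ.contDiffAt (hV.mem_nhds hx)).differentiableAt hm').hasFDerivAt
    have hux := ((huV.contDiffAt (hV.mem_nhds hx)).differentiableAt hm').hasFDerivAt
    exact hLΞx.add ((hux.sub (β.hasFDerivAt.comp x hLΞx)).smul_const y)
  have hGp : HasFDerivAt G (L : E →L[ℝ] F) p :=
    (hGd p hpV).congr_fderiv (by simp [hΞp.fderiv, hLu])
  obtain ⟨e, he, hpe, heV, hsymm, -⟩ :=
    exists_openPartialHomeomorph_of_contDiffOn hm' hV hG hpV hGp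
  refine ⟨e, hpe, heV.trans hVU, he ▸ hG.mono heV, hsymm, fun x ↦ by simp [he, G, hβy],
    fun x hx ↦ ?_⟩
  rw [he, (hGd x (heV hx)).fderiv]
  simp [hΞf x (heV hx), hLf, huf x (hVU (heV hx)), hβw]

end AdaptedCoordinates

section Charts

theorem isInvertible_mfderiv {𝕜 : Type*} [NontriviallyNormedField 𝕜] {E E' : Type*}
    [NormedAddCommGroup E] [NormedSpace 𝕜 E] [NormedAddCommGroup E'] [NormedSpace 𝕜 E']
    {H H' : Type*} [TopologicalSpace H] [TopologicalSpace H'] {I : ModelWithCorners 𝕜 E H}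
    {I' : ModelWithCorners 𝕜 E' H'} {M M' : Type*} [TopologicalSpace M] [ChartedSpace H M]
    [TopologicalSpace M'] [ChartedSpace H' M'] {e : OpenPartialHomeomorph M M'}
    (he : e.MDifferentiable I I') {x : M} (hx : x ∈ e.source) :
    (mfderiv I I' e x).IsInvertible :=
  ⟨he.mfderiv hx, rfl⟩

variable {E : Type*} [NormedAddCommGroup E] [NormedSpace ℝ E] {M : Type*} [TopologicalSpace M]
  [ChartedSpace E M] {ψ : OpenPartialHomeomorph M E}

theorem mdifferentiable_of_mem_maximalAtlas {m : WithTop ℕ∞} (hm : m ≠ 0)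
    (hψ : ψ ∈ IsManifold.maximalAtlas 𝓘(ℝ, E) m M) : ψ.MDifferentiable 𝓘(ℝ, E) 𝓘(ℝ, E) :=
  ⟨(contMDiffOn_of_mem_maximalAtlas hψ).mdifferentiableOn hm,
    (contMDiffOn_symm_of_mem_maximalAtlas hψ).mdifferentiableOn hm⟩

theorem trans_mem_maximalAtlas {m : WithTop ℕ∞} [IsManifold 𝓘(ℝ, E) m M]
    (hψ : ψ ∈ IsManifold.maximalAtlas 𝓘(ℝ, E) m M) {e : OpenPartialHomeomorph E E}
    (he : ContDiffOn ℝ m e e.source) (hesymm : ContDiffOn ℝ m e.symm e.target) :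
    ψ.trans e ∈ IsManifold.maximalAtlas 𝓘(ℝ, E) m M := by
  apply OpenPartialHomeomorph.mem_maximalAtlas_of_contMDiffOn
  · exact (contMDiffOn_iff_contDiffOn.2 he).comp
      ((contMDiffOn_of_mem_maximalAtlas hψ).mono fun q hq ↦ hq.1) fun q hq ↦ hq.2
  · exact (contMDiffOn_symm_of_mem_maximalAtlas hψ).comp
      ((contMDiffOn_iff_contDiffOn.2 hesymm).mono fun q hq ↦ hq.1) fun q hq ↦ hq.2

theorem mvfderiv_congr {F : Type*} [NormedAddCommGroup F] [NormedSpace ℝ F] {f f' : M → F} {q : M}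
    (h : f =ᶠ[𝓝 q] f') : mvfderiv 𝓘(ℝ, E) f q = mvfderiv 𝓘(ℝ, E) f' q :=
  ContinuousLinearMap.ext fun v ↦
    congrArg (fun A ↦ (A v : F)) (h.mfderiv_eq (I := 𝓘(ℝ, E)) (I' := 𝓘(ℝ, F)))

theorem mvfderiv_comp_chart {F : Type*} [NormedAddCommGroup F] [NormedSpace ℝ F]
    (hψ : ψ.MDifferentiable 𝓘(ℝ, E) 𝓘(ℝ, E)) {q : M} (hq : q ∈ ψ.source) {f : E → F}
    (hf : DifferentiableAt ℝ f (ψ q)) (v : TangentSpace 𝓘(ℝ, E) q) :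
    mvfderiv 𝓘(ℝ, E) (f ∘ ψ) q v = fderiv ℝ f (ψ q) (mfderiv 𝓘(ℝ, E) 𝓘(ℝ, E) ψ q v) := by
  rw [mvfderiv, mfderiv_comp q hf.mdifferentiableAt (hψ.mdifferentiableAt hq), mfderiv_eq_fderiv]
  rfl

theorem mpullback_symm_apply (hψ : ψ.MDifferentiable 𝓘(ℝ, E) 𝓘(ℝ, E)) {q : M}
    (hq : q ∈ ψ.source) (Z : Π x : M, TangentSpace 𝓘(ℝ, E) x) :
    mpullback 𝓘(ℝ, E) 𝓘(ℝ, E) ψ.symm Z (ψ q) = mfderiv 𝓘(ℝ, E) 𝓘(ℝ, E) ψ q (Z q) := by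
  refine (isInvertible_mfderiv hψ.symm (ψ.map_source hq)).inverse_apply_eq.2 ?_
  have hZ : (Z (ψ.symm (ψ q)) : E) = Z q := congrArg (fun x ↦ (Z x : E)) (ψ.left_inv hq)
  exact hZ.trans (DFunLike.congr_fun (hψ.symm_comp_deriv hq) (Z q)).symm

theorem contMDiff_fromTangentSpace_symm (w : E) :
    CMDiff ∞ (T% fun y : E ↦ ((NormedSpace.fromTangentSpace y).symm w :
      TangentSpace 𝓘(ℝ, E) y)) :=
  contMDiff_vectorSpace_iff_contDiff.2 (contDiff_const (c := w))

theorem mlieBracket_fromTangentSpace_symm (v w x : E) :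
    mlieBracket 𝓘(ℝ, E) (fun y : E ↦ (NormedSpace.fromTangentSpace (𝕜 := ℝ) y).symm v)
      (fun y ↦ (NormedSpace.fromTangentSpace y).symm w) x = 0 := by
  rw [← mlieBracketWithin_univ, mlieBracketWithin_eq_lieBracketWithin]
  change lieBracketWithin ℝ (fun _ ↦ v) (fun _ ↦ w) univ x = 0
  simp [lieBracketWithin]

/-- The vector field on the domain of a chart whose coordinate expression is the constant `w`. -/
noncomputable def chartConstField (ψ : OpenPartialHomeomorph M E) (w : E) (q : M) :
    TangentSpace 𝓘(ℝ, E) q :=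
  mpullback 𝓘(ℝ, E) 𝓘(ℝ, E) ψ (fun y ↦ (NormedSpace.fromTangentSpace y).symm w) q

theorem mfderiv_chartConstField (hψ : ψ.MDifferentiable 𝓘(ℝ, E) 𝓘(ℝ, E)) (w : E) {q : M}
    (hq : q ∈ ψ.source) : mfderiv 𝓘(ℝ, E) 𝓘(ℝ, E) ψ q (chartConstField ψ w q) = w :=
  (isInvertible_mfderiv hψ hq).self_apply_inverse w

variable [CompleteSpace E] [IsManifold 𝓘(ℝ, E) ∞ M]

theorem contDiffOn_mpullback_symm (hψ : ψ ∈ IsManifold.maximalAtlas 𝓘(ℝ, E) ∞ M)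
    {Z : Π x : M, TangentSpace 𝓘(ℝ, E) x} {W : Set M} (hW : IsOpen W)
    (hZ : CMDiff[W] ∞ (T% Z)) :
    ContDiffOn ℝ ∞ (mpullback 𝓘(ℝ, E) 𝓘(ℝ, E) ψ.symm Z : E → E) (ψ.target ∩ ψ.symm ⁻¹' W) := by
  have hψd := mdifferentiable_of_mem_maximalAtlas (by simp) hψ
  intro y hy
  exact (contMDiffAt_vectorSpace_iff_contDiffAt.1 (ContMDiffAt.mpullback_vectorField_preimage
    (hZ.contMDiffAt (hW.mem_nhds hy.2)) (contMDiffAt_symm_of_mem_maximalAtlas hψ hy.1)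
    (isInvertible_mfderiv hψd.symm hy.1) (by simp))).contDiffWithinAt

theorem contMDiffAt_chartConstField (hψ : ψ ∈ IsManifold.maximalAtlas 𝓘(ℝ, E) ∞ M) (w : E)
    {q : M} (hq : q ∈ ψ.source) : CMDiffAt ∞ (T% (chartConstField ψ w)) q :=
  ContMDiffAt.mpullback_vectorField_preimage (contMDiff_fromTangentSpace_symm w _)
    (contMDiffAt_of_mem_maximalAtlas hψ hq)
    (isInvertible_mfderiv (mdifferentiable_of_mem_maximalAtlas (by simp) hψ) hq) (by simp)

theorem mlieBracket_chartConstField (hψ : ψ ∈ IsManifold.maximalAtlas 𝓘(ℝ, E) ∞ M) (v w : E)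
    {q : M} (hq : q ∈ ψ.source) :
    mlieBracket 𝓘(ℝ, E) (chartConstField ψ v) (chartConstField ψ w) q = 0 := by
  have hle : minSmoothness ℝ 2 ≤ (∞ : WithTop ℕ∞) := by simpa using ENat.LEInfty.out
  have : IsManifold 𝓘(ℝ, E) (minSmoothness ℝ 2) M := .of_le (n := ∞) hle
  have h := mpullback_mlieBracket (I := 𝓘(ℝ, E)) (I' := 𝓘(ℝ, E)) (n := ∞)
    ((contMDiff_fromTangentSpace_symm v (ψ q)).mdifferentiableAt (by simp))
    ((contMDiff_fromTangentSpace_symm w (ψ q)).mdifferentiableAt (by simp))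
    (contMDiffAt_of_mem_maximalAtlas hψ hq) hle
  exact h.symm.trans (by rw [mpullback_apply, mlieBracket_fromTangentSpace_symm, map_zero])

end Charts

section OneForms

variable {E : Type*} [NormedAddCommGroup E] [NormedSpace ℝ E] {M : Type*} [TopologicalSpace M]
  [ChartedSpace E M]

/-- A one-form `α` is closed if `dα = 0`, where the exterior derivative is evaluated on vector
fields by `dα(X, Y) = X(α(Y)) - Y(α(X)) - α([X, Y])`. -/
def IsClosedOneForm [IsManifold 𝓘(ℝ, E) 1 M]
    (α : Π x : M, TangentSpace 𝓘(ℝ, E) x →L[ℝ] ℝ) : Prop :=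
  ∀ ⦃X Y : Π x : M, TangentSpace 𝓘(ℝ, E) x⦄ ⦃x : M⦄, MDiffAt (T% X) x → MDiffAt (T% Y) x →
    mvfderiv 𝓘(ℝ, E) (fun y ↦ α y (Y y)) x (X x) - mvfderiv 𝓘(ℝ, E) (fun y ↦ α y (X y)) x (Y x) =
      α x (mlieBracket 𝓘(ℝ, E) X Y x)

/-- The coordinate expression in a chart of a one-form, that is, its pullback by the inverse of
the chart. -/
noncomputable def chartOneForm (ψ : OpenPartialHomeomorph M E)
    (α : Π x : M, TangentSpace 𝓘(ℝ, E) x →L[ℝ] ℝ) (y : E) : E →L[ℝ] ℝ :=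
  (α (ψ.symm y)).comp (mfderiv 𝓘(ℝ, E) 𝓘(ℝ, E) ψ (ψ.symm y)).inverse

variable {ψ : OpenPartialHomeomorph M E} {α : Π x : M, TangentSpace 𝓘(ℝ, E) x →L[ℝ] ℝ}

theorem chartOneForm_apply {q : M} (hq : q ∈ ψ.source) (w : E) :
    chartOneForm ψ α (ψ q) w = α q (chartConstField ψ w q) :=
  congrArg (fun x ↦ α x (chartConstField ψ w x)) (ψ.left_inv hq)

theorem chartOneForm_apply_mfderiv (hψ : ψ.MDifferentiable 𝓘(ℝ, E) 𝓘(ℝ, E)) {q : M}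
    (hq : q ∈ ψ.source) (v : TangentSpace 𝓘(ℝ, E) q) :
    chartOneForm ψ α (ψ q) (mfderiv 𝓘(ℝ, E) 𝓘(ℝ, E) ψ q v) = α q v :=
  (chartOneForm_apply hq _).trans
    (congrArg (α q) ((isInvertible_mfderiv hψ hq).inverse_apply_self v))

theorem mvfderiv_apply_chartConstField (hψ : ψ.MDifferentiable 𝓘(ℝ, E) 𝓘(ℝ, E)) {q : M}
    (hq : q ∈ ψ.source) (hα : DifferentiableAt ℝ (chartOneForm ψ α) (ψ q)) (v w : E) :
    mvfderiv 𝓘(ℝ, E) (fun x ↦ α x (chartConstField ψ w x)) q (chartConstField ψ v q) =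
      fderiv ℝ (chartOneForm ψ α) (ψ q) v w := by
  have hαw := hα.hasFDerivAt.clm_apply (hasFDerivAt_const w (ψ q))
  have heq : (fun x ↦ α x (chartConstField ψ w x)) =ᶠ[𝓝 q] (chartOneForm ψ α · w) ∘ ψ := by
    filter_upwards [ψ.open_source.mem_nhds hq] with x hx
    exact (chartOneForm_apply hx w).symm
  rw [mvfderiv_congr heq, mvfderiv_comp_chart hψ hq hαw.differentiableAt, hαw.fderiv,
    mfderiv_chartConstField hψ v hq]
  simp

theorem contMDiffAt_oneForm_apply [IsManifold 𝓘(ℝ, E) 1 M] {m : WithTop ℕ∞}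
    {X : Π x : M, TangentSpace 𝓘(ℝ, E) x} {x : M}
    (hα : CMDiffAt m (fun x ↦ TotalSpace.mk' (E →L[ℝ] ℝ)
      (E := fun x : M ↦ TangentSpace 𝓘(ℝ, E) x →L[ℝ] ℝ) x (α x)) x)
    (hX : CMDiffAt m (T% X) x) : CMDiffAt m (fun y ↦ α y (X y)) x := by
  have h : ContMDiffAt 𝓘(ℝ, E) (𝓘(ℝ, E).prod 𝓘(ℝ)) m
      (fun y ↦ TotalSpace.mk' ℝ (E := Bundle.Trivial M ℝ) y (α y (X y))) x :=
    ContMDiffAt.clm_bundle_apply (F₁ := E) hα hX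
  simp only [contMDiffAt_totalSpace] at h
  exact h.2

variable [IsManifold 𝓘(ℝ, E) ∞ M]

theorem IsClosedOneForm.fderiv_chartOneForm_comm [CompleteSpace E]
    (hclosed : IsClosedOneForm α) (hψ : ψ ∈ IsManifold.maximalAtlas 𝓘(ℝ, E) ∞ M) {q : M}
    (hq : q ∈ ψ.source) (hα : DifferentiableAt ℝ (chartOneForm ψ α) (ψ q)) (v w : E) :
    fderiv ℝ (chartOneForm ψ α) (ψ q) v w = fderiv ℝ (chartOneForm ψ α) (ψ q) w v := by
  have hψd := mdifferentiable_of_mem_maximalAtlas (by simp) hψ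
  have h := hclosed ((contMDiffAt_chartConstField hψ v hq).mdifferentiableAt (by simp))
    ((contMDiffAt_chartConstField hψ w hq).mdifferentiableAt (by simp))
  rwa [mlieBracket_chartConstField hψ v w hq, map_zero, sub_eq_zero,
    mvfderiv_apply_chartConstField hψd hq hα, mvfderiv_apply_chartConstField hψd hq hα] at h

variable [FiniteDimensional ℝ E]

theorem contDiffOn_chartOneForm (hψ : ψ ∈ IsManifold.maximalAtlas 𝓘(ℝ, E) ∞ M)
    (hα : CMDiff ∞ (fun x ↦ TotalSpace.mk' (E →L[ℝ] ℝ)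
      (E := fun x : M ↦ TangentSpace 𝓘(ℝ, E) x →L[ℝ] ℝ) x (α x))) :
    ContDiffOn ℝ ∞ (chartOneForm ψ α) ψ.target := by
  have : CompleteSpace E := FiniteDimensional.complete ℝ E
  refine contDiffOn_clm_apply.2 fun w ↦ contMDiffOn_iff_contDiffOn.1 ?_
  have h : CMDiff[ψ.source] ∞ (fun q ↦ α q (chartConstField ψ w q)) := fun q hq ↦
    (contMDiffAt_oneForm_apply (hα q) (contMDiffAt_chartConstField hψ w hq)).contMDiffWithinAt
  exact h.comp (contMDiffOn_symm_of_mem_maximalAtlas hψ) ψ.mapsTo_symm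

theorem IsClosedOneForm.exists_contMDiffOn_mvfderiv_eq (hclosed : IsClosedOneForm α)
    (hα : CMDiff ∞ (fun x ↦ TotalSpace.mk' (E →L[ℝ] ℝ)
      (E := fun x : M ↦ TangentSpace 𝓘(ℝ, E) x →L[ℝ] ℝ) x (α x))) (p : M) :
    ∃ (W : Set M) (u : M → ℝ), IsOpen W ∧ p ∈ W ∧ CMDiff[W] ∞ u ∧
      ∀ q ∈ W, mvfderiv 𝓘(ℝ, E) u q = α q := by
  let ψ := chartAt E p
  have hψ : ψ ∈ IsManifold.maximalAtlas 𝓘(ℝ, E) ∞ M := IsManifold.chart_mem_maximalAtlas p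
  have hψd := mdifferentiable_of_mem_maximalAtlas (by simp) hψ
  have hpψ : p ∈ ψ.source := mem_chart_source E p
  obtain ⟨r, hr, hball⟩ := Metric.isOpen_iff.1 ψ.open_target (ψ p) (ψ.map_source hpψ)
  have hrep := contDiffOn_chartOneForm hψ hα
  have hrepd : ∀ y ∈ ψ.target, DifferentiableAt ℝ (chartOneForm ψ α) y := fun y hy ↦
    (hrep.contDiffAt (ψ.open_target.mem_nhds hy)).differentiableAt (by simp)
  obtain ⟨f, hf⟩ := (convex_ball (ψ p) r).exists_forall_hasFDerivAt_of_fderiv_symmetric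
    Metric.isOpen_ball (fun y hy ↦ (hrepd y (hball hy)).differentiableWithinAt)
    fun y hy v w ↦ by
      rw [← ψ.right_inv (hball hy)]
      exact hclosed.fderiv_chartOneForm_comm hψ (ψ.map_target (hball hy))
        (hrepd _ (ψ.map_source (ψ.map_target (hball hy)))) v w
  have hfsmooth : ContDiffOn ℝ ∞ f (Metric.ball (ψ p) r) :=
    (contDiffOn_infty_iff_fderiv_of_isOpen Metric.isOpen_ball).2
      ⟨fun y hy ↦ (hf y hy).differentiableAt.differentiableWithinAt,
        (hrep.mono hball).congr fun y hy ↦ (hf y hy).fderiv⟩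
  refine ⟨ψ.source ∩ ψ ⁻¹' Metric.ball (ψ p) r, f ∘ ψ,
    ψ.isOpen_inter_preimage Metric.isOpen_ball, ⟨hpψ, Metric.mem_ball_self hr⟩,
    (contMDiffOn_iff_contDiffOn.2 hfsmooth).comp
      ((contMDiffOn_of_mem_maximalAtlas hψ).mono inter_subset_left) inter_subset_right,
    fun q hq ↦ ContinuousLinearMap.ext fun v ↦ ?_⟩
  rw [mvfderiv_comp_chart hψd hq.1 (hf _ hq.2).differentiableAt, (hf _ hq.2).fderiv,
    chartOneForm_apply_mfderiv hψd hq.1]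

end OneForms

section AdaptedCharts

variable {E : Type*} [NormedAddCommGroup E] [NormedSpace ℝ E] {M : Type*} [TopologicalSpace M]
  [ChartedSpace E M]

theorem fderiv_comp_chart_symm {F : Type*} [NormedAddCommGroup F] [NormedSpace ℝ F]
    {ψ : OpenPartialHomeomorph M E} (hψ : ψ.MDifferentiable 𝓘(ℝ, E) 𝓘(ℝ, E)) {q : M}
    (hq : q ∈ ψ.source) {f : M → F} (hf : MDiffAt f q) (v : TangentSpace 𝓘(ℝ, E) q) :
    fderiv ℝ (f ∘ ψ.symm) (ψ q) (mfderiv 𝓘(ℝ, E) 𝓘(ℝ, E) ψ q v) = mvfderiv 𝓘(ℝ, E) f q v := by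
  have hfψ : DifferentiableAt ℝ (f ∘ ψ.symm) (ψ q) := by
    refine mdifferentiableAt_iff_differentiableAt.1 (MDifferentiableAt.comp _ ?_
      (hψ.symm.mdifferentiableAt (ψ.map_source hq)))
    rwa [ψ.left_inv hq]
  have heq : (f ∘ ψ.symm) ∘ ψ =ᶠ[𝓝 q] f := by
    filter_upwards [ψ.open_source.mem_nhds hq] with x hx
    exact congrArg f (ψ.left_inv hx)
  rw [← mvfderiv_comp_chart hψ hq hfψ, mvfderiv_congr heq]

variable [FiniteDimensional ℝ E] [IsManifold 𝓘(ℝ, E) ∞ M]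

theorem exists_adapted_chart {β : E →L[ℝ] ℝ} {w : E} (hβ : β ≠ 0) (hw : w ≠ 0) (hβw : β w = 0)
    {Z : Π x : M, TangentSpace 𝓘(ℝ, E) x} {u : M → ℝ} {W : Set M} (hW : IsOpen W)
    (hZ : CMDiff[W] ∞ (T% Z)) (hu : CMDiff[W] ∞ u)
    (huZ : ∀ q ∈ W, mvfderiv 𝓘(ℝ, E) u q (Z q) = 0) {p : M} (hp : p ∈ W) (hZp : Z p ≠ 0)
    (hup : mvfderiv 𝓘(ℝ, E) u p ≠ 0) :
    ∃ φ ∈ IsManifold.maximalAtlas 𝓘(ℝ, E) ∞ M, p ∈ φ.source ∧ φ.source ⊆ W ∧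
      ∀ q ∈ φ.source, β (φ q) = u q ∧ mfderiv 𝓘(ℝ, E) 𝓘(ℝ, E) φ q (Z q) = w := by
  have : CompleteSpace E := FiniteDimensional.complete ℝ E
  let ψ := chartAt E p
  have hψ : ψ ∈ IsManifold.maximalAtlas 𝓘(ℝ, E) ∞ M := IsManifold.chart_mem_maximalAtlas p
  have hψd := mdifferentiable_of_mem_maximalAtlas (by simp) hψ
  have hpψ : p ∈ ψ.source := mem_chart_source E p
  have hfu : ∀ q ∈ ψ.source, q ∈ W → ∀ v, fderiv ℝ (u ∘ ψ.symm) (ψ q)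
      (mfderiv 𝓘(ℝ, E) 𝓘(ℝ, E) ψ q v) = mvfderiv 𝓘(ℝ, E) u q v := fun q hq hqW ↦
    fderiv_comp_chart_symm hψd hq ((hu.contMDiffAt (hW.mem_nhds hqW)).mdifferentiableAt (by simp))
  obtain ⟨e, hpe, heU, he, hesymm, heu, heZ⟩ := exists_adapted_openPartialHomeomorph (m := ⊤)
    (by simp) rfl hβ hw hβw (f := mpullback 𝓘(ℝ, E) 𝓘(ℝ, E) ψ.symm Z) (u := u ∘ ψ.symm) (p := ψ p)
    (ψ.symm.isOpen_inter_preimage hW) (contDiffOn_mpullback_symm hψ hW hZ)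
    (contMDiffOn_iff_contDiffOn.1 (hu.comp
      ((contMDiffOn_symm_of_mem_maximalAtlas hψ).mono inter_subset_left) inter_subset_right))
    (by
      rintro y ⟨hy, hyW⟩
      obtain ⟨q, hq, rfl⟩ : ∃ q ∈ ψ.source, ψ q = y := ⟨_, ψ.map_target hy, ψ.right_inv hy⟩
      have hqW : q ∈ W := by rwa [mem_preimage, ψ.left_inv hq] at hyW
      rw [mpullback_symm_apply hψd hq, hfu q hq hqW, huZ q hqW])
    ⟨ψ.map_source hpψ, by rwa [mem_preimage, ψ.left_inv hpψ]⟩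
    (by
      rw [mpullback_symm_apply hψd hpψ]
      exact (map_ne_zero_iff _ (isInvertible_mfderiv hψd hpψ).injective).2 hZp)
    (fun h ↦ hup (ContinuousLinearMap.ext fun v ↦ by rw [← hfu p hpψ hp, h]; rfl))
  refine ⟨ψ.trans e, trans_mem_maximalAtlas hψ he hesymm, ⟨hpψ, hpe⟩, fun q hq ↦ ?_,
    fun q hq ↦ ⟨?_, ?_⟩⟩
  · simpa [ψ.left_inv hq.1] using (heU hq.2).2
  · simp [heu, ψ.left_inv hq.1]
  · have hed : DifferentiableAt ℝ e (ψ q) :=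
      (he.contDiffAt (e.open_source.mem_nhds hq.2)).differentiableAt (by simp)
    rw [← heZ (ψ q) hq.2, mpullback_symm_apply hψd hq.1]
    exact mvfderiv_comp_chart hψd hq.1 hed (Z q)

end AdaptedCharts

section Coordinates

variable {n : ℕ} {M : Type*} [TopologicalSpace M] [ChartedSpace (EuclideanSpace ℝ (Fin n)) M]
  [IsManifold (𝓡 n) ∞ M]

theorem exists_chart_chartCoord_eq_coordField_eq {Z : Π x : M, TangentSpace (𝓡 n) x} {u : M → ℝ}
    {W : Set M} (hW : IsOpen W)
    (hZ : ContMDiffOn (𝓡 n) ((𝓡 n).prod 𝓘(ℝ, EuclideanSpace ℝ (Fin n))) ∞ (T% Z) W)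
    (hu : ContMDiffOn (𝓡 n) 𝓘(ℝ) ∞ u W) (huZ : ∀ q ∈ W, mvfderiv (𝓡 n) u q (Z q) = 0)
    {p : M} (hp : p ∈ W) (hZp : Z p ≠ 0) (hup : mvfderiv (𝓡 n) u p ≠ 0) :
    ∃ (hn : 2 ≤ n) (φ : OpenPartialHomeomorph M (EuclideanSpace ℝ (Fin n))),
      φ ∈ IsManifold.maximalAtlas (𝓡 n) ∞ M ∧ p ∈ φ.source ∧ φ.source ⊆ W ∧
      ∀ q ∈ φ.source, chartCoord φ ⟨0, Nat.zero_lt_of_lt hn⟩ q = u q ∧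
        coordField φ ⟨1, hn⟩ q = Z q := by
  have hn : 2 ≤ n := by
    have h := two_le_finrank_of_apply_eq_zero (K := ℝ) (V := EuclideanSpace ℝ (Fin n))
      (α := (mvfderiv (𝓡 n) u p : EuclideanSpace ℝ (Fin n) →L[ℝ] ℝ).toLinearMap)
      (fun h ↦ hup (ContinuousLinearMap.coe_injective h)) hZp (huZ p hp)
    rwa [finrank_euclideanSpace_fin] at h
  let i₀ : Fin n := ⟨0, Nat.zero_lt_of_lt hn⟩
  let i₁ : Fin n := ⟨1, hn⟩
  have hβ : (EuclideanSpace.proj i₀ : EuclideanSpace ℝ (Fin n) →L[ℝ] ℝ) ≠ 0 := fun h ↦ by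
    simpa using DFunLike.congr_fun h (EuclideanSpace.single i₀ 1)
  obtain ⟨φ, hφ, hpφ, hφW, hadapted⟩ := exists_adapted_chart hβ
    (w := EuclideanSpace.single i₁ 1) (by simp) (by simp [i₀, i₁]) hW hZ hu huZ hp hZp hup
  have hφd := mdifferentiable_of_mem_maximalAtlas (by simp) hφ
  exact ⟨hn, φ, hφ, hpφ, hφW, fun q hq ↦ ⟨(hadapted q hq).1,
    (isInvertible_mfderiv hφd hq).inverse_apply_eq.2 (hadapted q hq).2.symm⟩⟩

end Coordinates

namespace LorentzMetric

variable {n : ℕ} {M : Type*} [TopologicalSpace M] [ChartedSpace (EuclideanSpace ℝ (Fin n)) M]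
  [IsManifold (𝓡 n) ∞ M] {g : LorentzMetric n M} {Z : Π x : M, TangentSpace (𝓡 n) x}

theorem val_ne_zero {x : M} {v : TangentSpace (𝓡 n) x} (hv : v ≠ 0) : g.val x v ≠ 0 :=
  fun h ↦ hv (g.eq_zero_of_forall x v fun w ↦ by rw [h]; rfl)

theorem grad_eq_of_mvfderiv_eq {f : M → ℝ} {x : M} {v : TangentSpace (𝓡 n) x}
    (h : mvfderiv (𝓡 n) f x = g.val x v) : g.grad f x = v := by
  rw [grad, h]
  exact (g.flat x).symm_apply_apply v

theorem contMDiff_val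
    (hZ : ContMDiff (𝓡 n) ((𝓡 n).prod 𝓘(ℝ, EuclideanSpace ℝ (Fin n))) ∞ (T% Z)) :
    ContMDiff (𝓡 n) ((𝓡 n).prod 𝓘(ℝ, EuclideanSpace ℝ (Fin n) →L[ℝ] ℝ)) ∞
      (fun x ↦ TotalSpace.mk' (EuclideanSpace ℝ (Fin n) →L[ℝ] ℝ)
            (E := fun x : M ↦ TangentSpace (𝓡 n) x →L[ℝ] ℝ) x (g.val x (Z x))) := fun x ↦
  ContMDiffAt.clm_bundle_apply (F₁ := EuclideanSpace ℝ (Fin n)) (g.contMDiff x) (hZ x)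

theorem IsCovariantlyConstant.isClosedOneForm_val (hconst : g.IsCovariantlyConstant Z)
    (hZ : ∀ x, VFDiffAt Z x) : IsClosedOneForm fun x ↦ g.val x (Z x) := by
  intro X Y x hX hY
  rw [g.leviCivita_metric hX (hZ x) hY, g.leviCivita_metric hY (hZ x) hX, hconst x,
    ← (CovariantDerivative.torsion_eq_zero_iff _).1 g.leviCivita_torsion hX hY]
  simp

theorem IsCovariantlyConstant.exists_mvfderiv_eq_val (hconst : g.IsCovariantlyConstant Z)
    (hZ : ContMDiff (𝓡 n) ((𝓡 n).prod 𝓘(ℝ, EuclideanSpace ℝ (Fin n))) ∞ (T% Z)) (p : M) :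
    ∃ (W : Set M) (u : M → ℝ), IsOpen W ∧ p ∈ W ∧ ContMDiffOn (𝓡 n) 𝓘(ℝ) ∞ u W ∧
      ∀ q ∈ W, mvfderiv (𝓡 n) u q = g.val q (Z q) :=
  (hconst.isClosedOneForm_val fun x ↦
    (hZ x).mdifferentiableAt (by simp)).exists_contMDiffOn_mvfderiv_eq (contMDiff_val hZ) p

end LorentzMetric

theorem theorem3p1 {n : ℕ} {M : Type*} [TopologicalSpace M]
    [ChartedSpace (EuclideanSpace ℝ (Fin n)) M] [IsManifold (𝓡 n) ∞ M]
    (g : LorentzMetric n M) (Z : Π x : M, TangentSpace (𝓡 n) x)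
    (hZ : ContMDiff (𝓡 n) ((𝓡 n).prod 𝓘(ℝ, EuclideanSpace ℝ (Fin n))) ∞
      (fun x ↦ TotalSpace.mk' (EuclideanSpace ℝ (Fin n)) x (Z x)))
    (hnull : g.IsNull Z) (hconst : g.IsCovariantlyConstant Z) (p : M) :
    ∃ (hn : 2 ≤ n) (φ : OpenPartialHomeomorph M (EuclideanSpace ℝ (Fin n))),
      φ ∈ IsManifold.maximalAtlas (𝓡 n) ∞ M ∧ p ∈ φ.source ∧
      ∀ q ∈ φ.source,
        Z q = coordField φ ⟨1, hn⟩ q ∧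
        Z q = g.grad (chartCoord φ ⟨0, Nat.zero_lt_of_lt hn⟩) q := by
  obtain ⟨W, u, hW, hp, hu, hdu⟩ := hconst.exists_mvfderiv_eq_val hZ p
  have huZ : ∀ q ∈ W, mvfderiv (𝓡 n) u q (Z q) = 0 := fun q hq ↦ by
    rw [hdu q hq, (hnull q).2]
  have hup : mvfderiv (𝓡 n) u p ≠ 0 := by
    rw [hdu p hp]
    exact LorentzMetric.val_ne_zero (hnull p).1
  obtain ⟨hn, φ, hφ, hpφ, hφW, hcoord⟩ := exists_chart_chartCoord_eq_coordField_eq hW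
    hZ.contMDiffOn hu huZ hp (hnull p).1 hup
  refine ⟨hn, φ, hφ, hpφ, fun q hq ↦ ⟨(hcoord q hq).2.symm, ?_⟩⟩
  refine (LorentzMetric.grad_eq_of_mvfderiv_eq ?_).symm
  rw [← hdu q (hφW hq)]
  apply mvfderiv_congr
  filter_upwards [φ.open_source.mem_nhds hq] with x hx using (hcoord x hx).1
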